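/- Let $D\subset\mathbb{R}^d$ be a bounded domain with Lipschitz (in particular, smooth) boundary, $\partial D=\Gamma_1\cup\Gamma_2\cup\Gamma_3$ with $\Gamma_1,\Gamma_2,\Gamma_3$ pairwise disjoint and measurable for the surface measure, and $\mathrm{meas}(\Gamma_1)>0$. Let $V=\{v\in H^1(D): v=0 \text{ on }\Gamma_1\}$ with the inner product of $H^1(D)$, where boundary values are understood in the sense of traces, let $V^*$ be its dual and $\langle\cdot,\cdot\rangle$ the duality pairing. Let $b\in L^2(\Gamma_2)$ be such that there exists $u_b\in V$ with $u_b\ge 0$ in $D$ and $u_b=b$ on $\Gamma_2$. Let $p_0:D\times\mathbb{R}\to\mathbb{R}$ satisfy: (a) there is $L_0>0$ such that for a.e. $x\in D$, $|p_0(x,r)-p_0(x,s)|\le L_0|r-s|$ for all $r,s\in\mathbb{R}$; (b) for a.e. $x\in D$, $(p_0(x,r)-p_0(x,s))(r-s)\ge 0$ for all $r,s\in\mathbb{R}$; (c) for every $r\in\mathbb{R}$, $x\mapsto p_0(x,r)$ is measurable on $D$; (d) for a.e. $x\in D$ and all $r\in\mathbb{R}$, $p_0(x,r)=0$ if and only if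 $r\ge 0$. Put $$K=\{v\in V: v\ge 0\text{ in }D,\ v=b\text{ on }\Gamma_2\},\qquad \widetilde K=\{v\in V: v=b\text{ on }\Gamma_2\}.$$ Then $\widetilde K$ is a closed convex subset of $V$ with $K\subset\widetilde K$. Moreover, for all $u,v\in V$ the function $x\mapsto p_0(x,u(x))v(x)$ is integrable on $D$, the formula $$\langle Gu,v\rangle=\int_D p_0(x,u(x))\,v(x)\,dx\qquad(u,v\in V)$$ defines an operator $G:V\to V^*$, and: (i) $G$ is bounded (it maps bounded sets to bounded sets), demicontinuous ($u_n\to u$ in $V$ implies $Gu_n\rightharpoonup Gu$ weakly in $V^*$) and monotone ($\langle Gu-Gv,u-v\rangle\ge0$ for all $u,v\in V$); (ii) $\langle Gu,v-u\rangle\le 0$ for all $u\in\widetilde K$ and $v\in K$; (iii) if $u\in\widetilde K$ and $\langle Gu,v-u\rangle=0$ for all $v\in K$, then $u\in K$. -/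

import Mathlib

open MeasureTheory Set Filter Topology
open scoped ContDiff InnerProductSpace RealInnerProductSpace

noncomputable section

namespace HeatTransfer

/-! ## Abstract conditions on operators and sets in a normed space -/

section Abstract

variable {X : Type*} [NormedAddCommGroup X] [NormedSpace ℝ X]

/-- `A : X → X*` maps bounded sets of `X` into bounded sets of `X*`. -/
def IsBoundedOperator (A : X → StrongDual ℝ X) : Prop :=
  ∀ s : Set X, Bornology.IsBounded s → Bornology.IsBounded (A '' s)

/-- Weak convergence of a sequence in a normed space, tested against all elements of the dual. -/
def WeakTendsto {Y : Type*} [NormedAddCommGroup Y] [NormedSpace ℝ Y] (y : ℕ → Y) (y₀ : Y) : Prop :=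
  ∀ ξ : StrongDual ℝ Y, Tendsto (fun n => ξ (y n)) atTop (𝓝 (ξ y₀))

/-- `uₙ → u` in `X` implies `A uₙ ⇀ A u` weakly in `X*`. -/
def IsDemicontinuous (A : X → StrongDual ℝ X) : Prop :=
  ∀ (u : ℕ → X) (u₀ : X), Tendsto u atTop (𝓝 u₀) → WeakTendsto (fun n => A (u n)) (A u₀)

/-- `⟨A u - A v, u - v⟩ ≥ 0` for all `u, v`. -/
def IsMonotoneOperator (A : X → StrongDual ℝ X) : Prop :=
  ∀ u v : X, 0 ≤ (A u - A v) (u - v)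

/-- The condition on the enlarged constraint set `Kt` relative to the constraint set `K`. -/
structure ConditionK (K Kt : Set X) : Prop where
  isClosed : IsClosed Kt
  convex : Convex ℝ Kt
  subset : K ⊆ Kt

/-- The condition on the penalty operator `G : X → X*` relative to `K` and `Kt`. -/
structure ConditionG (K Kt : Set X) (G : X → StrongDual ℝ X) : Prop where
  bounded : IsBoundedOperator G
  demicontinuous : IsDemicontinuous G
  monotone : IsMonotoneOperator G
  nonpos : ∀ u ∈ Kt, ∀ v ∈ K, G u (v - u) ≤ 0
  mem_of_eq_zero : ∀ u ∈ Kt, (∀ v ∈ K, G u (v - u) = 0) → u ∈ K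

end Abstract

/-! ## Domains and their boundaries -/

/-- Euclidean space `ℝᵈ`. -/
abbrev E (d : ℕ) : Type := EuclideanSpace ℝ (Fin d)

/-- The surface measure: the `(d-1)`-dimensional Hausdorff measure on `ℝᵈ`, normalized so as to
agree with Lebesgue measure on `(d-1)`-dimensional flat pieces (counting measure if `d = 1`). -/
def surfaceMeasure (d : ℕ) : Measure (E d) := Measure.euclideanHausdorffMeasure (d - 1)

/-- `D` has a Lipschitz boundary: near each boundary point there are a unit vector `e` and a
Lipschitz function `γ` of the coordinates orthogonal to `e` (i.e. `γ` is invariant under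
translations along `e`) such that `D` is, locally, the set of points above the graph of `γ` in the
direction `e`. -/
def HasLipschitzBoundary {d : ℕ} (D : Set (E d)) : Prop :=
  ∀ x ∈ frontier D, ∃ r > 0, ∃ e : E d, ‖e‖ = 1 ∧ ∃ (γ : E d → ℝ) (L : NNReal),
    LipschitzWith L γ ∧ (∀ (y : E d) (t : ℝ), γ (y + t • e) = γ y) ∧
    D ∩ Metric.ball x r = {y ∈ Metric.ball x r | γ y < ⟪e, y⟫}

/-- `D` is a bounded domain with Lipschitz boundary, partitioned into the measurable
sets `Γ₁`, `Γ₂`, `Γ₃`, the first of which has positive surface measure. -/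
structure IsHeatDomain {d : ℕ} (D Γ₁ Γ₂ Γ₃ : Set (E d)) : Prop where
  isOpen : IsOpen D
  isConnected : IsConnected D
  isBounded : Bornology.IsBounded D
  lipschitz : HasLipschitzBoundary D
  frontier_eq : frontier D = Γ₁ ∪ Γ₂ ∪ Γ₃
  disjoint₁₂ : Disjoint Γ₁ Γ₂
  disjoint₁₃ : Disjoint Γ₁ Γ₃
  disjoint₂₃ : Disjoint Γ₂ Γ₃
  measurable₁ : NullMeasurableSet Γ₁ (surfaceMeasure d)
  measurable₂ : NullMeasurableSet Γ₂ (surfaceMeasure d)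
  measurable₃ : NullMeasurableSet Γ₃ (surfaceMeasure d)
  meas_pos : 0 < surfaceMeasure d Γ₁

/-! ## The Sobolev space `H¹(D)` -/

/-- `L²(D)`. -/
abbrev L2 {d : ℕ} (D : Set (E d)) : Type := Lp ℝ 2 (volume.restrict D)

/-- `L²(D)ᵈ`. -/
abbrev L2vec {d : ℕ} (D : Set (E d)) : Type := Lp (E d) 2 (volume.restrict D)

/-- `L²(Γ)` for a part `Γ` of the boundary, with respect to the surface measure. -/
abbrev L2bdry {d : ℕ} (Γ : Set (E d)) : Type := Lp ℝ 2 ((surfaceMeasure d).restrict Γ)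

/-- `g` is the weak gradient of `u` in `D`:
`∫_D u ∂_w φ dx = - ∫_D (g · w) φ dx` for all `φ ∈ C_c^∞(D)` and all directions `w`. -/
def IsWeakGradient {d : ℕ} (D : Set (E d)) (u : L2 D) (g : L2vec D) : Prop :=
  ∀ φ : E d → ℝ, ContDiff ℝ ∞ φ → HasCompactSupport φ → tsupport φ ⊆ D → ∀ w : E d,
    ∫ x in D, u x * fderiv ℝ φ x w = - ∫ x in D, ⟪g x, w⟫ * φ x

theorem integrable_L2_mul {d : ℕ} {D : Set (E d)} (u : L2 D) {ψ : E d → ℝ}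
    (hψ : Continuous ψ) (hc : HasCompactSupport ψ) :
    Integrable (fun x => u x * ψ x) (volume.restrict D) :=
  (Lp.memLp u).integrable_mul (q := 2) (hψ.memLp_of_hasCompactSupport hc)

theorem integrable_L2vec_mul {d : ℕ} {D : Set (E d)} (g : L2vec D) (w : E d) {ψ : E d → ℝ}
    (hψ : Continuous ψ) (hc : HasCompactSupport ψ) :
    Integrable (fun x => ⟪g x, w⟫ * ψ x) (volume.restrict D) :=
  ((Lp.memLp g).inner_const w).integrable_mul (q := 2) (hψ.memLp_of_hasCompactSupport hc)

/-- The subspace of `L²(D) × L²(D)ᵈ` (with its Hilbert product norm) of the pairs `(u, ∇u)`. -/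
def h1Submodule {d : ℕ} (D : Set (E d)) : Submodule ℝ (WithLp 2 (L2 D × L2vec D)) where
  carrier := {p | IsWeakGradient D p.fst p.snd}
  zero_mem' := by
    intro φ _ _ _ w
    have h1 : (fun x => ((0 : L2 D) : E d → ℝ) x * fderiv ℝ φ x w)
        =ᵐ[volume.restrict D] fun _ => 0 := by
      filter_upwards [Lp.coeFn_zero ℝ 2 (volume.restrict D)] with x hx
      rw [hx]; simp
    have h2 : (fun x => ⟪((0 : L2vec D) : E d → E d) x, w⟫ * φ x)
        =ᵐ[volume.restrict D] fun _ => 0 := by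
      filter_upwards [Lp.coeFn_zero (E d) 2 (volume.restrict D)] with x hx
      rw [hx]; simp
    have e1 := integral_congr_ae h1
    have e2 := integral_congr_ae h2
    simp only [integral_zero] at e1 e2
    change ∫ x in D, ((0 : L2 D) : E d → ℝ) x * fderiv ℝ φ x w
      = - ∫ x in D, ⟪((0 : L2vec D) : E d → E d) x, w⟫ * φ x
    rw [e1, e2, neg_zero]
  add_mem' := by
    intro p q hp hq φ h1 h2 h3 w
    have hd : Continuous fun x => fderiv ℝ φ x w :=
      (h1.continuous_fderiv (by simp)).clm_apply continuous_const
    have hdc : HasCompactSupport fun x => fderiv ℝ φ x w := h2.fderiv_apply (𝕜 := ℝ) w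
    have e1 : ∫ x in D, ((p.fst + q.fst : L2 D) : E d → ℝ) x * fderiv ℝ φ x w
        = (∫ x in D, p.fst x * fderiv ℝ φ x w) + ∫ x in D, q.fst x * fderiv ℝ φ x w := by
      rw [← integral_add (integrable_L2_mul p.fst hd hdc) (integrable_L2_mul q.fst hd hdc)]
      refine integral_congr_ae ?_
      filter_upwards [Lp.coeFn_add p.fst q.fst] with x hx
      rw [hx, Pi.add_apply, add_mul]
    have e2 : ∫ x in D, ⟪((p.snd + q.snd : L2vec D) : E d → E d) x, w⟫ * φ x
        = (∫ x in D, ⟪p.snd x, w⟫ * φ x) + ∫ x in D, ⟪q.snd x, w⟫ * φ x := by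
      rw [← integral_add (integrable_L2vec_mul p.snd w h1.continuous h2)
        (integrable_L2vec_mul q.snd w h1.continuous h2)]
      refine integral_congr_ae ?_
      filter_upwards [Lp.coeFn_add p.snd q.snd] with x hx
      simp only [hx, Pi.add_apply, inner_add_left, add_mul]
    change ∫ x in D, ((p.fst + q.fst : L2 D) : E d → ℝ) x * fderiv ℝ φ x w
      = - ∫ x in D, ⟪((p.snd + q.snd : L2vec D) : E d → E d) x, w⟫ * φ x
    rw [e1, e2, hp φ h1 h2 h3 w, hq φ h1 h2 h3 w, neg_add]
  smul_mem' := by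
    intro c p hp φ h1 h2 h3 w
    have e1 : ∫ x in D, ((c • p.fst : L2 D) : E d → ℝ) x * fderiv ℝ φ x w
        = c * ∫ x in D, p.fst x * fderiv ℝ φ x w := by
      rw [← integral_const_mul]
      refine integral_congr_ae ?_
      filter_upwards [Lp.coeFn_smul c p.fst] with x hx
      simp [hx, mul_assoc]
    have e2 : ∫ x in D, ⟪((c • p.snd : L2vec D) : E d → E d) x, w⟫ * φ x
        = c * ∫ x in D, ⟪p.snd x, w⟫ * φ x := by
      rw [← integral_const_mul]
      refine integral_congr_ae ?_
      filter_upwards [Lp.coeFn_smul c p.snd] with x hx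
      simp only [hx, Pi.smul_apply, real_inner_smul_left, mul_assoc]
    change ∫ x in D, ((c • p.fst : L2 D) : E d → ℝ) x * fderiv ℝ φ x w
      = - ∫ x in D, ⟪((c • p.snd : L2vec D) : E d → E d) x, w⟫ * φ x
    rw [e1, e2, hp φ h1 h2 h3 w, mul_neg]

/-- The Sobolev space `H¹(D)` of the functions `u ∈ L²(D)` with a weak gradient `∇u ∈ L²(D)ᵈ`. An
element is recorded as the pair `(u, ∇u)`, the second component being determined by the first. -/
def H1 {d : ℕ} (D : Set (E d)) : Type := h1Submodule D

instance {d : ℕ} (D : Set (E d)) : NormedAddCommGroup (H1 D) :=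
  inferInstanceAs (NormedAddCommGroup (h1Submodule D))

/-- The inner product of `H¹(D)` is `(u, v) = ∫_D u v dx + ∫_D ∇u · ∇v dx`. -/
instance {d : ℕ} (D : Set (E d)) : InnerProductSpace ℝ (H1 D) :=
  inferInstanceAs (InnerProductSpace ℝ (h1Submodule D))

/-- The function in `L²(D)` underlying an element of `H¹(D)`. -/
def H1.fn {d : ℕ} {D : Set (E d)} (v : H1 D) : L2 D := v.1.fst

/-- The weak gradient of an element of `H¹(D)`. -/
def H1.grad {d : ℕ} {D : Set (E d)} (v : H1 D) : L2vec D := v.1.snd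

theorem H1.isWeakGradient {d : ℕ} {D : Set (E d)} (v : H1 D) : IsWeakGradient D v.fn v.grad := v.2

theorem H1.inner_eq {d : ℕ} {D : Set (E d)} (u v : H1 D) :
    ⟪u, v⟫ = (∫ x in D, u.fn x * v.fn x) + ∫ x in D, ⟪u.grad x, v.grad x⟫ := by
  have h : ⟪u, v⟫ = ⟪u.fn, v.fn⟫ + ⟪u.grad, v.grad⟫ := rfl
  rw [h, L2.inner_def, L2.inner_def]
  simp [mul_comm]

/-! ## Traces -/

/-- The graph of the restriction map `φ|_D ↦ φ|_Γ` on smooth functions up to the boundary. -/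
def restrictionGraph {d : ℕ} (D Γ : Set (E d)) : Submodule ℝ (H1 D × L2bdry Γ) where
  carrier := {p | ∃ φ : E d → ℝ, ContDiff ℝ ∞ φ ∧
    p.1.fn =ᵐ[volume.restrict D] φ ∧
    p.2 =ᵐ[(surfaceMeasure d).restrict Γ] φ}
  zero_mem' := ⟨fun _ => 0, contDiff_const, Lp.coeFn_zero _ _ _, Lp.coeFn_zero _ _ _⟩
  add_mem' := by
    rintro p q ⟨φ, hφ, h1, h2⟩ ⟨ψ, hψ, k1, k2⟩
    exact ⟨φ + ψ, hφ.add hψ, (Lp.coeFn_add _ _).trans (h1.add k1),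
      (Lp.coeFn_add _ _).trans (h2.add k2)⟩
  smul_mem' := by
    rintro c p ⟨φ, hφ, h1, h2⟩
    exact ⟨c • φ, hφ.const_smul c, (Lp.coeFn_smul _ _).trans (h1.const_smul c),
      (Lp.coeFn_smul _ _).trans (h2.const_smul c)⟩

/-- The graph of the trace map `H¹(D) → L²(Γ)`: the continuous extension to `H¹(D)` of the
restriction map on smooth functions, i.e. the closure of its graph in `H¹(D) × L²(Γ)`. -/
def traceGraph {d : ℕ} (D Γ : Set (E d)) : Submodule ℝ (H1 D × L2bdry Γ) :=
  (restrictionGraph D Γ).topologicalClosure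

/-- `v = g` on `Γ` in the sense of traces: there are smooth `φₙ` with `φₙ → v` in `H¹(D)` and
`φₙ|_Γ → g` in `L²(Γ)`. -/
def TraceEq {d : ℕ} {D : Set (E d)} (Γ : Set (E d)) (v : H1 D) (g : L2bdry Γ) : Prop :=
  (v, g) ∈ traceGraph D Γ

/-- `V = {v ∈ H¹(D) : v = 0 on Γ₁}`, with the inner product and the norm of `H¹(D)`. -/
def V {d : ℕ} (D Γ₁ : Set (E d)) : Submodule ℝ (H1 D) where
  carrier := {v | TraceEq Γ₁ v 0}
  zero_mem' := (traceGraph D Γ₁).zero_mem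
  add_mem' := by
    intro u v hu hv
    have h := (traceGraph D Γ₁).add_mem hu hv
    rwa [Prod.mk_add_mk, add_zero] at h
  smul_mem' := by
    intro c u hu
    have h := (traceGraph D Γ₁).smul_mem c hu
    rwa [Prod.smul_mk, smul_zero] at h

/-- The function on `D` underlying an element of `V`. -/
def toFun {d : ℕ} {D Γ₁ : Set (E d)} (v : V D Γ₁) : L2 D := (v : H1 D).fn

/-! ## The data and the objects of the penalty problem -/

/-- `K = {v ∈ V : v ≥ 0 in D, v = b on Γ₂}`. -/
def constraintSet {d : ℕ} (D Γ₁ Γ₂ : Set (E d)) (b : L2bdry Γ₂) : Set (V D Γ₁) :=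
  {v | (∀ᵐ x ∂(volume.restrict D), 0 ≤ toFun v x) ∧ TraceEq Γ₂ (v : H1 D) b}

/-- `K̃ = {v ∈ V : v = b on Γ₂}`. -/
def relaxedSet {d : ℕ} (D Γ₁ Γ₂ : Set (E d)) (b : L2bdry Γ₂) : Set (V D Γ₁) :=
  {v | TraceEq Γ₂ (v : H1 D) b}

/-- The condition on the boundary temperature `b ∈ L²(Γ₂)`: there is `u_b ∈ V` with `u_b ≥ 0` in `D`
and `u_b = b` on `Γ₂`. -/
def ConditionB {d : ℕ} (D Γ₁ Γ₂ : Set (E d)) (b : L2bdry Γ₂) : Prop :=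
  ∃ ub : V D Γ₁, (∀ᵐ x ∂(volume.restrict D), 0 ≤ toFun ub x) ∧ TraceEq Γ₂ (ub : H1 D) b

/-- The condition on the penalty function `p₀ : D × ℝ → ℝ` (only its values at points of `D`
matter). Measurability on `D` is Lebesgue measurability. -/
structure ConditionP {d : ℕ} (D : Set (E d)) (p₀ : E d → ℝ → ℝ) : Prop where
  lipschitz : ∃ L₀ : ℝ, 0 < L₀ ∧ ∀ᵐ x ∂(volume.restrict D), ∀ r s : ℝ,
    |p₀ x r - p₀ x s| ≤ L₀ * |r - s|
  monotone : ∀ᵐ x ∂(volume.restrict D), ∀ r s : ℝ, 0 ≤ (p₀ x r - p₀ x s) * (r - s)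
  measurable : ∀ r : ℝ, AEMeasurable (fun x => p₀ x r) (volume.restrict D)
  eq_zero_iff : ∀ᵐ x ∂(volume.restrict D), ∀ r : ℝ, p₀ x r = 0 ↔ 0 ≤ r

end HeatTransfer

end

namespace HeatTransfer

section Nemytskii

variable {α : Type*} [MeasurableSpace α] {μ : Measure α} {p : α → ℝ → ℝ} {L : ℝ}

/-! Condition (d) gives `p₀ x 0 = 0`, so the Lipschitz bound makes the superposition map `N u =
p₀(·, u(·))` a Lipschitz map of `L²(D)` into itself. Let `j : V → L²(D)` be the embedding. Then `G =
j* ∘ N ∘ j`, with `L²(D)` identified with its dual, is Lipschitz from `V` to `V*`; hence it is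
bounded and even norm continuous. Monotonicity of `G` is that of `p₀ x` under the integral.

The penalty property is a sign argument. Almost everywhere `p₀ x` vanishes on `[0, ∞)` and is
negative on `(-∞, 0)`, so `p₀ x r * (s - r) ≤ 0` whenever `s ≥ 0`, strictly if `r < 0`. Integration
gives (ii). For (iii) the single competitor `u_b` suffices: an integrand of one sign with zero
integral vanishes a.e., which rules out `u < 0` on a set of positive measure. -/

theorem aemeasurable_comp_simpleFunc (hm : ∀ r, AEMeasurable (fun x => p x r) μ)
    (s : SimpleFunc α ℝ) : AEMeasurable (fun x => p x (s x)) μ := by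
  -- Splitting along the finitely many fibres of `s` leaves only sections with `r` frozen, where
  -- measurability is assumed.
  have h : (fun x => p x (s x))
      = fun x => ∑ r ∈ s.range, (s ⁻¹' {r}).indicator (fun y => p y r) x := by
    funext x
    rw [Finset.sum_eq_single_of_mem (s x) (s.mem_range_self x)]
    · simp
    · intro r _ hr
      exact Set.indicator_of_notMem (fun hx => hr hx.symm) _
  rw [h]
  exact Finset.aemeasurable_fun_sum _ fun r _ => (hm r).indicator (s.measurableSet_fiber r)

/-- Superposition with a Carathéodory function preserves almost everywhere measurability. -/
theorem aemeasurable_superposition (hm : ∀ r, AEMeasurable (fun x => p x r) μ)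
    (hc : ∀ᵐ x ∂μ, Continuous (p x)) {u : α → ℝ} (hu : AEStronglyMeasurable u μ) :
    AEMeasurable (fun x => p x (u x)) μ := by
  -- Simple functions approximate a strongly measurable version of `u` pointwise; continuity in `r`
  -- carries the limit through `p x`.
  refine aemeasurable_of_tendsto_metrizable_ae atTop
    (fun n => aemeasurable_comp_simpleFunc hm (hu.stronglyMeasurable_mk.approx n)) ?_
  filter_upwards [hc, hu.ae_eq_mk] with x hx hux
  rw [hux]
  exact (hx.tendsto _).comp (hu.stronglyMeasurable_mk.tendsto_approx x)

/-- Comparison with `s = 0` turns the Lipschitz bound into linear growth, `|p x r| ≤ L * |r|`, so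
`u` itself dominates for any exponent. -/
theorem memLp_superposition (hm : ∀ r, AEMeasurable (fun x => p x r) μ)
    (hL : ∀ᵐ x ∂μ, ∀ r s, |p x r - p x s| ≤ L * |r - s|) (h0 : ∀ᵐ x ∂μ, p x 0 = 0)
    {q : ENNReal} (u : Lp ℝ q μ) : MemLp (fun x => p x (u x)) q μ := by
  have hc : ∀ᵐ x ∂μ, Continuous (p x) := by
    filter_upwards [hL] with x hx
    refine (LipschitzWith.of_dist_le' (K := L) fun r s => ?_).continuous
    simpa only [Real.dist_eq] using hx r s
  refine (Lp.memLp u).of_le_mul (c := L)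
    (aemeasurable_superposition hm hc (Lp.aestronglyMeasurable u)).aestronglyMeasurable ?_
  filter_upwards [hL, h0] with x hx h0x
  simpa [h0x] using hx (u x) 0

theorem lipschitzWith_superposition (hm : ∀ r, AEMeasurable (fun x => p x r) μ)
    (hL : ∀ᵐ x ∂μ, ∀ r s, |p x r - p x s| ≤ L * |r - s|) (h0 : ∀ᵐ x ∂μ, p x 0 = 0)
    {q : ENNReal} [Fact (1 ≤ q)] :
    LipschitzWith (Real.toNNReal L)
      fun u : Lp ℝ q μ => (memLp_superposition hm hL h0 u).toLp _ := by
  refine LipschitzWith.of_dist_le' fun u v => ?_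
  rw [dist_eq_norm, dist_eq_norm]
  refine Lp.norm_le_mul_norm_of_ae_le_mul ?_
  filter_upwards [hL, Lp.coeFn_sub u v, Lp.coeFn_sub ((memLp_superposition hm hL h0 u).toLp _)
    ((memLp_superposition hm hL h0 v).toLp _), (memLp_superposition hm hL h0 u).coeFn_toLp,
    (memLp_superposition hm hL h0 v).coeFn_toLp] with x hx h1 h2 h3 h4
  rw [h1, h2, Pi.sub_apply, Pi.sub_apply, h3, h4]
  exact hx _ _

end Nemytskii

section Abstract

variable {X : Type*} [NormedAddCommGroup X] [NormedSpace ℝ X]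

theorem isBoundedOperator_of_lipschitzWith {A : X → StrongDual ℝ X} {C : NNReal}
    (hA : LipschitzWith C A) : IsBoundedOperator A :=
  fun _ hs => hA.isBounded_image hs

/-- Norm convergence in the dual implies weak convergence. -/
theorem isDemicontinuous_of_continuous {A : X → StrongDual ℝ X} (hA : Continuous A) :
    IsDemicontinuous A :=
  fun _ u₀ hu ξ => (ξ.continuous.tendsto _).comp ((hA.tendsto u₀).comp hu)

end Abstract

variable {d : ℕ} {D Γ₁ Γ₂ : Set (E d)}

/-- The embedding of `V` into `L²(D)`. -/
noncomputable def toFunL (D Γ₁ : Set (E d)) : V D Γ₁ →L[ℝ] L2 D :=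
  ((WithLp.fstL 2 ℝ (L2 D) (L2vec D)).comp (h1Submodule D).subtypeL).comp (V D Γ₁).subtypeL

theorem toFunL_apply (v : V D Γ₁) : toFunL D Γ₁ v = toFun v := rfl

theorem toFun_sub_ae (u v : V D Γ₁) :
    toFun (u - v) =ᵐ[volume.restrict D] fun x => toFun u x - toFun v x := by
  rw [← toFunL_apply, map_sub]
  exact Lp.coeFn_sub _ _

/-- The relaxed set is the preimage of the trace graph, a closed linear subspace, under the
continuous affine map `v ↦ (v, b)`. -/
theorem conditionK (D Γ₁ Γ₂ : Set (E d)) (b : L2bdry Γ₂) :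
    ConditionK (constraintSet D Γ₁ Γ₂ b) (relaxedSet D Γ₁ Γ₂ b) where
  isClosed := by
    have h : IsClosed (traceGraph D Γ₂ : Set (H1 D × L2bdry Γ₂)) :=
      Submodule.isClosed_topologicalClosure _
    exact h.preimage (continuous_subtype_val.prodMk continuous_const)
  convex := by
    intro u hu v hv s t hs ht hst
    have h := (traceGraph D Γ₂).convex hu hv hs ht hst
    rw [Prod.smul_mk, Prod.smul_mk, Prod.mk_add_mk, ← add_smul, hst, one_smul] at h
    exact h
  subset := fun _ hv => hv.2

/-! ### The penalty function and the penalty operator -/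

namespace ConditionP

variable {p₀ : E d → ℝ → ℝ}

theorem apply_zero (hp : ConditionP D p₀) : ∀ᵐ x ∂(volume.restrict D), p₀ x 0 = 0 :=
  hp.eq_zero_iff.mono fun _ hx => (hx 0).2 le_rfl

/-- Monotonicity against `0` gives `p₀ x r * r ≥ 0`, hence `p₀ x r ≤ 0` for `r < 0`; the zero set
`[0, ∞)` excludes equality. -/
theorem neg_of_neg (hp : ConditionP D p₀) :
    ∀ᵐ x ∂(volume.restrict D), ∀ r < 0, p₀ x r < 0 := by
  filter_upwards [hp.eq_zero_iff, hp.monotone] with x hx hm r hr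
  have h0 : p₀ x 0 = 0 := (hx 0).2 le_rfl
  have hne : p₀ x r ≠ 0 := fun h => hr.not_ge ((hx r).1 h)
  have h := hm r 0
  rw [h0, sub_zero, sub_zero] at h
  exact lt_of_le_of_ne (nonpos_of_mul_nonneg_left h hr) hne

/-- Against a nonnegative competitor, the penalty integrand is nonpositive. -/
theorem mul_sub_nonpos (hp : ConditionP D p₀) :
    ∀ᵐ x ∂(volume.restrict D), ∀ r s : ℝ, 0 ≤ s → p₀ x r * (s - r) ≤ 0 := by
  filter_upwards [hp.eq_zero_iff, hp.neg_of_neg] with x hx hn r s hs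
  rcases le_or_gt 0 r with hr | hr
  · rw [(hx r).2 hr, zero_mul]
  · exact mul_nonpos_of_nonpos_of_nonneg (hn r hr).le (by linarith)

theorem memLp (hp : ConditionP D p₀) (u : L2 D) :
    MemLp (fun x => p₀ x (u x)) 2 (volume.restrict D) := by
  obtain ⟨L, -, hL⟩ := hp.lipschitz
  exact memLp_superposition hp.measurable hL hp.apply_zero u

theorem integrable_mul (hp : ConditionP D p₀) (u v : L2 D) :
    Integrable (fun x => p₀ x (u x) * v x) (volume.restrict D) :=
  (hp.memLp u).integrable_mul (q := 2) (Lp.memLp v)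

/-- The penalty operator `⟨G u, v⟩ = ∫_D p₀(x, u(x)) v(x) dx`. -/
noncomputable def penaltyOperator (hp : ConditionP D p₀) (Γ₁ : Set (E d)) (u : V D Γ₁) :
    StrongDual ℝ (V D Γ₁) :=
  (innerSL ℝ ((hp.memLp (toFun u)).toLp _)).comp (toFunL D Γ₁)

theorem penaltyOperator_apply (hp : ConditionP D p₀) (u v : V D Γ₁) :
    hp.penaltyOperator Γ₁ u v = ∫ x in D, p₀ x (toFun u x) * toFun v x := by
  change ⟪(hp.memLp (toFun u)).toLp _, toFun v⟫ = _
  rw [L2.inner_def]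
  refine integral_congr_ae ?_
  filter_upwards [(hp.memLp (toFun u)).coeFn_toLp] with x hx
  rw [hx]
  simp [mul_comm]

theorem penaltyOperator_apply_sub (hp : ConditionP D p₀) (u v w : V D Γ₁) :
    hp.penaltyOperator Γ₁ u (v - w)
      = ∫ x in D, p₀ x (toFun u x) * (toFun v x - toFun w x) := by
  rw [penaltyOperator_apply]
  refine integral_congr_ae ?_
  filter_upwards [toFun_sub_ae v w] with x hx
  rw [hx]

theorem integrable_mul_sub (hp : ConditionP D p₀) (u v w : L2 D) :
    Integrable (fun x => p₀ x (u x) * (v x - w x)) (volume.restrict D) := by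
  simp only [mul_sub]
  exact (hp.integrable_mul u v).sub (hp.integrable_mul u w)

theorem exists_lipschitzWith_penaltyOperator (hp : ConditionP D p₀) (Γ₁ : Set (E d)) :
    ∃ C, LipschitzWith C (hp.penaltyOperator Γ₁) := by
  obtain ⟨L, -, hL⟩ := hp.lipschitz
  -- From the inside out: embedding into `L²(D)`, superposition, Riesz map, precomposition with the
  -- embedding. Each factor is Lipschitz.
  exact ⟨_, (((ContinuousLinearMap.compL ℝ (V D Γ₁) (L2 D) ℝ).flip (toFunL D Γ₁)).lipschitz.comp
    (innerSL ℝ (E := L2 D)).lipschitz).comp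
      ((lipschitzWith_superposition hp.measurable hL hp.apply_zero).comp (toFunL D Γ₁).lipschitz)⟩

theorem isMonotone_penaltyOperator (hp : ConditionP D p₀) (Γ₁ : Set (E d)) :
    IsMonotoneOperator (hp.penaltyOperator Γ₁) := by
  intro u v
  rw [sub_apply, penaltyOperator_apply_sub, penaltyOperator_apply_sub,
    ← integral_sub (hp.integrable_mul_sub _ _ _) (hp.integrable_mul_sub _ _ _)]
  refine integral_nonneg_of_ae ?_
  filter_upwards [hp.monotone] with x hx
  rw [← sub_mul]
  exact hx _ _

theorem conditionG (hp : ConditionP D p₀) {b : L2bdry Γ₂} (hb : ConditionB D Γ₁ Γ₂ b) :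
    ConditionG (constraintSet D Γ₁ Γ₂ b) (relaxedSet D Γ₁ Γ₂ b) (hp.penaltyOperator Γ₁) where
  bounded := isBoundedOperator_of_lipschitzWith
    (hp.exists_lipschitzWith_penaltyOperator Γ₁).choose_spec
  demicontinuous := isDemicontinuous_of_continuous
    (hp.exists_lipschitzWith_penaltyOperator Γ₁).choose_spec.continuous
  monotone := hp.isMonotone_penaltyOperator Γ₁
  nonpos := by
    intro u _ v hv
    rw [penaltyOperator_apply_sub]
    refine integral_nonpos_of_ae ?_
    filter_upwards [hp.mul_sub_nonpos, hv.1] with x hx hvx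
    exact hx _ _ hvx
  mem_of_eq_zero := by
    intro u hu h
    obtain ⟨w, hw, hwb⟩ := hb
    refine ⟨?_, hu⟩
    have hint := h w ⟨hw, hwb⟩
    -- The sign is reversed so that the integrand becomes nonnegative and the zero-integral
    -- criterion applies.
    rw [penaltyOperator_apply_sub, ← neg_eq_zero, ← integral_neg] at hint
    have hzero := (integral_eq_zero_iff_of_nonneg_ae ?_ (hp.integrable_mul_sub _ _ _).neg).1 hint
    · filter_upwards [hzero, hp.neg_of_neg, hw] with x hx hn hwx
      -- Where `u < 0 ≤ w`, both `p₀ x (u x) < 0` and `w x - u x > 0`, so the integrand could not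
      -- vanish.
      by_contra! hux
      have h1 : p₀ x (toFun u x) * (toFun w x - toFun u x) < 0 :=
        mul_neg_of_neg_of_pos (hn _ hux) (by linarith)
      have h2 : -(p₀ x (toFun u x) * (toFun w x - toFun u x)) = 0 := hx
      linarith
    · filter_upwards [hp.mul_sub_nonpos, hw] with x hx hwx
      exact neg_nonneg.2 (hx _ _ hwx)

end ConditionP

end HeatTransfer

theorem mainTheorem10 {d : ℕ} (D Γ₁ Γ₂ Γ₃ : Set (HeatTransfer.E d))
    (hD : HeatTransfer.IsHeatDomain D Γ₁ Γ₂ Γ₃)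
    (b : HeatTransfer.L2bdry Γ₂) (hb : HeatTransfer.ConditionB D Γ₁ Γ₂ b)
    (p₀ : HeatTransfer.E d → ℝ → ℝ) (hp : HeatTransfer.ConditionP D p₀) :
    HeatTransfer.ConditionK (HeatTransfer.constraintSet D Γ₁ Γ₂ b)
        (HeatTransfer.relaxedSet D Γ₁ Γ₂ b) ∧
      ∃ G : HeatTransfer.V D Γ₁ → StrongDual ℝ (HeatTransfer.V D Γ₁),
        (∀ u v : HeatTransfer.V D Γ₁,
          IntegrableOn
            (fun x => p₀ x (HeatTransfer.toFun u x) * HeatTransfer.toFun v x) D volume ∧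
          G u v = ∫ x in D, p₀ x (HeatTransfer.toFun u x) * HeatTransfer.toFun v x) ∧
        HeatTransfer.ConditionG (HeatTransfer.constraintSet D Γ₁ Γ₂ b)
          (HeatTransfer.relaxedSet D Γ₁ Γ₂ b) G := by
  exact ⟨HeatTransfer.conditionK D Γ₁ Γ₂ b, hp.penaltyOperator Γ₁,
    fun u v => ⟨hp.integrable_mul _ _, hp.penaltyOperator_apply u v⟩, hp.conditionG hb⟩
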